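/- Let $G$ be a finite group and $N\lhd G$ a normal subgroup with $Q=G/N$ abelian. Let $\mathrm{Irr}\,G$ be the set of irreducible complex characters of $G$, and let the character group $\hat Q=\mathrm{Hom}(Q,\mathbb{C}^\times)$ act on $\mathrm{Irr}\,G$ by tensoring, $(\chi\otimes\rho)(g)=\chi(gN)\rho(g)$. For $\rho\in\mathrm{Irr}\,G$ write $[\rho]$ for its $\hat Q$-orbit and $\mathrm{Stab}_{\hat Q}(\rho)\subset\hat Q$ for its stabilizer. For $q\in G$ let $C_q$ be the set of conjugacy classes of $G$ contained in the coset $qN$, and let $R_q$ be the set of $\hat Q$-orbits $[\rho]$ on $\mathrm{Irr}\,G$ with $\rho$ not identically $0$ on $qN$. Let $\langle f_1,f_2\rangle=\frac1{\#N}\sum_{n\in N}f_1(n)\overline{f_2(n)}$ be the usual inner product of functions on $N$. Then: (1) For every $\rho\in\mathrm{Irr}\,G$, $\ \#\mathrm{Stab}_{\hat Q}(\rho)=\langle \mathrm{Res}_N\rho,\mathrm{Res}_N\rho\rangle$. (2) For every $\rho\in\mathrm{Irr}\,G$ and $q\in G$, $\ [\rho]\in R_q$ if and only if the image of $q$ in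 $Q$ lies in $\bigcap_{\chi\in\mathrm{Stab}_{\hat Q}(\rho)}\ker\chi$. (3) For all $q\in G$ and all integers $k\ge 1$, $\ R_q\subset R_{q^k}$ and $\#C_q\le\#C_{q^k}$. (4) If $G/N$ is cyclic, generated by the image of $q\in G$, then for every $\rho\in\mathrm{Irr}\,G$: $\ [\rho]\in R_q$ if and only if $\mathrm{Stab}_{\hat Q}(\rho)$ is trivial, if and only if $\mathrm{Res}_N\rho$ is an irreducible character of $N$. -/

import Mathlib

open scoped Pointwise

noncomputable section

/-- `f` is the character of an irreducible complex (finite-dimensional) representation of `H`. -/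
def IsIrrChar {H : Type*} [Group H] (f : H → ℂ) : Prop :=
  ∃ (n : ℕ) (σ : Representation ℂ H (Fin n → ℂ)), σ.IsIrreducible ∧ σ.character = f

/-- `Irr H`, the set of irreducible complex characters of `H`. -/
def IrrChar (H : Type*) [Group H] : Type _ := {f : H → ℂ // IsIrrChar f}

instance irrCharCoeFun {H : Type*} [Group H] : CoeFun (IrrChar H) (fun _ => H → ℂ) := ⟨Subtype.val⟩

/-- The inner product `⟨f₁, f₂⟩ = (1 / #H) ∑_{h ∈ H} f₁(h) conj(f₂(h))` of complex functions on a
finite group. -/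
def charInner {H : Type*} [Group H] [Finite H] (f₁ f₂ : H → ℂ) : ℂ :=
  (Nat.card H : ℂ)⁻¹ * ∑ᶠ h : H, f₁ h * starRingEnd ℂ (f₂ h)

/-- Restriction to the subgroup `N` of a function on `G`. -/
def resFun {G : Type*} [Group G] (N : Subgroup G) (f : G → ℂ) : N → ℂ := fun x => f x

/-- The character group of `G ⧸ N`, for `G ⧸ N` abelian: its one-dimensional complex
characters. -/
abbrev QuotDual {G : Type*} [Group G] (N : Subgroup G) [N.Normal] : Type _ := (G ⧸ N) →* ℂˣ

section Twist

variable {G : Type*} [Group G] (N : Subgroup G) [N.Normal]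

/-- The representation `χ ⊗ σ` for a one-dimensional character `χ` of `G ⧸ N`. -/
def twistRep {n : ℕ} (χ : QuotDual N) (σ : Representation ℂ G (Fin n → ℂ)) :
    Representation ℂ G (Fin n → ℂ) where
  toFun g := ((χ (g : G ⧸ N) : ℂˣ) : ℂ) • σ g
  map_one' := by simp
  map_mul' a b := by
    ext v
    simp [mul_assoc, mul_left_comm]

theorem twistRep_isIrreducible {n : ℕ} (χ : QuotDual N) (σ : Representation ℂ G (Fin n → ℂ))
    (h : σ.IsIrreducible) : (twistRep N χ σ).IsIrreducible := by
  let e : Subrepresentation (twistRep N χ σ) ≃o Subrepresentation σ :=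
    { toFun := fun W => ⟨W.toSubmodule, fun g v hv => by
        have h1 := W.apply_mem_toSubmodule g hv
        exact (W.toSubmodule.smul_mem_iff (χ (g : G ⧸ N)).ne_zero).1 h1⟩
      invFun := fun W => ⟨W.toSubmodule, fun g v hv =>
        W.toSubmodule.smul_mem _ (W.apply_mem_toSubmodule g hv)⟩
      left_inv := fun W => rfl
      right_inv := fun W => rfl
      map_rel_iff' := Iff.rfl }
  exact e.isSimpleOrder_iff.2 h

/-- The action of the character group of `G ⧸ N` on `Irr G` by tensoring:
`(χ • ρ)(g) = χ(gN) ρ(g)`. -/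
instance quotDualMulAction : MulAction (QuotDual N) (IrrChar G) where
  smul χ ρ := ⟨fun g => ((χ (g : G ⧸ N) : ℂˣ) : ℂ) * ρ g, by
    obtain ⟨f, n, σ, hσ, rfl⟩ := ρ
    refine ⟨n, twistRep N χ σ, twistRep_isIrreducible N χ σ hσ, ?_⟩
    funext g
    simp [Representation.character, twistRep]⟩
  one_smul ρ := Subtype.ext (funext fun g => by
    change (((1 : QuotDual N) (g : G ⧸ N) : ℂˣ) : ℂ) * ρ g = ρ g
    simp)
  mul_smul χ ψ ρ := Subtype.ext (funext fun g => by
    change (((χ * ψ) (g : G ⧸ N) : ℂˣ) : ℂ) * ρ g = (χ (g : G ⧸ N) : ℂ) * ((ψ (g : G ⧸ N) : ℂ) * ρ g)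
    simp [mul_assoc])

theorem quotDual_smul_apply (χ : QuotDual N) (ρ : IrrChar G) (g : G) :
    (χ • ρ) g = ((χ (g : G ⧸ N) : ℂˣ) : ℂ) * ρ g := rfl

/-- The stabilizer of `ρ ∈ Irr G` in the character group of `G ⧸ N`. -/
abbrev charStab (ρ : IrrChar G) : Subgroup (QuotDual N) := MulAction.stabilizer (QuotDual N) ρ

/-- The set of orbits of the character group of `G ⧸ N` on `Irr G`. -/
abbrev CharOrbits : Type _ := MulAction.orbitRel.Quotient (QuotDual N) (IrrChar G)

/-- The orbit `[ρ]` of `ρ ∈ Irr G`. -/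
abbrev charOrbit (ρ : IrrChar G) : CharOrbits N :=
  Quotient.mk (MulAction.orbitRel (QuotDual N) (IrrChar G)) ρ

/-- `C_q`: the set of conjugacy classes of `G` inside the coset `qN`. -/
def cosetClasses (q : G) : Set (ConjClasses G) := {c | c.carrier ⊆ q • (N : Set G)}

/-- `R_q`: the set of orbits `[ρ]` with `ρ` not identically zero on the coset `qN`. -/
def cosetOrbits (q : G) : Set (CharOrbits N) :=
  {ω | ∃ ρ : IrrChar G, charOrbit N ρ = ω ∧ ∃ g ∈ q • (N : Set G), ρ g ≠ 0}

/-- Membership of `[ρ]` in `R_q` does not depend on the representative. -/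
theorem charOrbit_mem_cosetOrbits_iff (q : G) (ρ : IrrChar G) :
    charOrbit N ρ ∈ cosetOrbits N q ↔ ∃ g ∈ q • (N : Set G), ρ g ≠ 0 := by
  refine ⟨?_, fun h => ⟨ρ, rfl, h⟩⟩
  rintro ⟨ρ', h, g, hg, h0⟩
  obtain ⟨χ, rfl⟩ : ∃ χ : QuotDual N, χ • ρ = ρ' := Quotient.exact h
  exact ⟨g, hg, right_ne_zero_of_mul h0⟩

end Twist

end

/-!
The first two assertions and the fourth rest on one identity, `sum_coset_mul_conj`:
`(1 / #N) ∑_{n ∈ N} |ρ(qn)|² = ∑_{χ ∈ Stab(ρ)} χ(q)⁻¹`.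
For `q = 1` the right side is the order of the stabilizer, which is the first assertion. In general
it is the order of the stabilizer, hence nonzero, when every `χ ∈ Stab(ρ)` is trivial at `q`;
conversely, if `χ • ρ = ρ` and `ρ(g) ≠ 0` for some `g ∈ qN`, then `χ(q) = χ(g) = 1`. This is the
second assertion, and the inclusion of the sets of orbits in the third follows from it. When the
image of `q` generates `G ⧸ N`, only the trivial `χ` is trivial at `q`; and a trivial stabilizer
means that the restriction of `ρ` to `N` has norm one, that is, is irreducible.

The inequality between numbers of conjugacy classes needs no characters. By Burnside's lemma, the
number of classes in `qN` is the average over `g ∈ G` of the number of elements of `qN` that commute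
with `g`. If `h₀` is one of them, multiplication by `h₀⁻¹ h₀ ^ k` injects them into the elements of
`q ^ k N` that commute with `g`.
-/

/-! ### Orthogonality of irreducible characters -/

open scoped ComplexOrder in
/-- Unitary trick: the positive definite form `P = ∑ g, (σ g)ᴴ (σ g)` is `H`-invariant, so it
conjugates `σ h⁻¹` into `(σ h)ᴴ`, and the traces agree. -/
theorem Representation.character_inv_eq_conj {H : Type*} [Group H] [Finite H] {n : ℕ}
    (σ : Representation ℂ H (Fin n → ℂ)) (h : H) :
    σ.character h⁻¹ = starRingEnd ℂ (σ.character h) := by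
  classical
  have := Fintype.ofFinite H
  let A : H →* Matrix (Fin n) (Fin n) ℂ :=
    (LinearMap.toMatrixAlgEquiv' : _ ≃ₐ[ℂ] Matrix (Fin n) (Fin n) ℂ).toMonoidHom.comp σ
  have hA : ∀ g, σ.character g = (A g).trace := fun g => by
    rw [Representation.character, LinearMap.trace_eq_matrix_trace ℂ (Pi.basisFun ℂ (Fin n))]
    rfl
  let P : Matrix (Fin n) (Fin n) ℂ := ∑ g : H, (A g).conjTranspose * A g
  have hP : P.PosDef := by
    have h1 : P = 1 + ∑ g ∈ Finset.univ.erase (1 : H), (A g).conjTranspose * A g := by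
      rw [show P = _ from (Finset.add_sum_erase _ _ (Finset.mem_univ (1 : H))).symm]
      simp
    rw [h1]
    exact Matrix.PosDef.one.add_posSemidef
      (Matrix.posSemidef_sum _ fun g _ => Matrix.posSemidef_conjTranspose_mul_self (A g))
  have hinv : (A h).conjTranspose * P * A h = P := by
    simp only [P, Finset.mul_sum, Finset.sum_mul]
    refine Fintype.sum_equiv (Equiv.mulRight h) _ _ fun g => ?_
    simp [map_mul, Matrix.conjTranspose_mul, mul_assoc]
  have hmul : P * A h⁻¹ = (A h).conjTranspose * P := by
    rw [← hinv, mul_assoc, ← map_mul, mul_inv_cancel, map_one, mul_one, hinv]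
  have hu : IsUnit P.det := (Matrix.isUnit_iff_isUnit_det P).1 hP.isUnit
  rw [hA, hA, starRingEnd_apply, ← Matrix.trace_conjTranspose]
  calc (A h⁻¹).trace = (P⁻¹ * (P * A h⁻¹)).trace := by
        rw [← mul_assoc, Matrix.nonsing_inv_mul _ hu, one_mul]
    _ = (A h).conjTranspose.trace := by
        rw [hmul, Matrix.trace_mul_comm, mul_assoc, Matrix.mul_nonsing_inv _ hu, mul_one]

theorem charInner_self_eq_finrank {H : Type*} [Group H] [Finite H] {n : ℕ}
    (σ : Representation ℂ H (Fin n → ℂ)) :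
    charInner σ.character σ.character = Module.finrank ℂ (σ.IntertwiningMap σ) := by
  have := Fintype.ofFinite H
  have : Invertible (Nat.card H : ℂ) := invertibleOfNonzero (Nat.cast_ne_zero.2 Nat.card_pos.ne')
  rw [← Representation.card_inv_mul_sum_char_mul_char_eq_finrank, charInner,
    finsum_eq_sum_of_fintype]
  simp only [Representation.character_inv_eq_conj]

/-- Schur's lemma and, by way of Maschke's theorem, its converse: if the only self-intertwining maps
are scalars, then so is the projection onto a subrepresentation along an invariant complement. -/
theorem Representation.isIrreducible_iff_finrank_intertwiningMap {H : Type*} [Group H] [Finite H]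
    {n : ℕ} (σ : Representation ℂ H (Fin n → ℂ)) :
    σ.IsIrreducible ↔ Module.finrank ℂ (σ.IntertwiningMap σ) = 1 := by
  refine ⟨fun h => Representation.IsIrreducible.finrank_intertwiningMap_self σ, fun h => ?_⟩
  have : NeZero (Nat.card H : ℂ) := ⟨Nat.cast_ne_zero.2 Nat.card_pos.ne'⟩
  obtain ⟨f₀, hf₀, -⟩ := finrank_eq_one_iff'.1 h
  -- the zero representation is excluded because it has no nonzero self-intertwining map
  have hV : Nontrivial (Fin n → ℂ) := by
    by_contra hc
    rw [not_nontrivial_iff_subsingleton] at hc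
    exact hf₀ (Representation.IntertwiningMap.ext (LinearMap.ext fun v => Subsingleton.elim _ _))
  let one : σ.IntertwiningMap σ := ⟨LinearMap.id, fun g => rfl⟩
  have hone : one ≠ 0 := fun hc => by
    obtain ⟨v, hv⟩ := exists_ne (0 : Fin n → ℂ)
    exact hv (congrArg (fun f : σ.IntertwiningMap σ => f v) hc)
  refine @IsSimpleOrder.mk _ _ _ ⟨⊥, ⊤, fun hc => ?_⟩ fun W => ?_
  · exact bot_ne_top (congrArg Subrepresentation.toSubmodule hc : (⊥ : Submodule ℂ (Fin n → ℂ)) = ⊤)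
  obtain ⟨W', hW⟩ := exists_isCompl W
  have hc : IsCompl W.toSubmodule W'.toSubmodule := by
    refine IsCompl.of_eq ?_ ?_
    · exact congrArg Subrepresentation.toSubmodule hW.inf_eq_bot
    · exact congrArg Subrepresentation.toSubmodule hW.sup_eq_top
  let p : σ.IntertwiningMap σ := ⟨Submodule.projection _ _ hc, fun g => by
    refine LinearMap.ext fun v => ?_
    obtain ⟨a, ha, b, hb, rfl⟩ : ∃ a ∈ W.toSubmodule, ∃ b ∈ W'.toSubmodule, a + b = v :=
      Submodule.mem_sup.1 (hc.sup_eq_top ▸ Submodule.mem_top)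
    have key : ∀ a ∈ W.toSubmodule, ∀ b ∈ W'.toSubmodule,
        Submodule.projection _ _ hc (a + b) = a := by
      intro a ha b hb
      rw [map_add, Submodule.projection_apply_of_mem_left hc ha,
        (Submodule.projection_apply_eq_zero_iff hc).2 hb, add_zero]
    simp only [LinearMap.comp_apply]
    rw [key a ha b hb, map_add,
      key _ (W.apply_mem_toSubmodule g ha) _ (W'.apply_mem_toSubmodule g hb)]⟩
  obtain ⟨c, hcp⟩ := (finrank_eq_one_iff_of_nonzero' one hone).1 h p
  have hp : ∀ v, Submodule.projection _ _ hc v = c • v := fun v =>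
    (congrArg (fun f : σ.IntertwiningMap σ => f v) hcp).symm
  by_cases h0 : c = 0
  · left
    refine Subrepresentation.toSubmodule_injective ((Submodule.eq_bot_iff _).2 fun v hv => ?_)
    rw [← Submodule.projection_apply_of_mem_left hc hv, hp, h0, zero_smul]
  · right
    refine Subrepresentation.toSubmodule_injective ((Submodule.eq_top_iff').2 fun v => ?_)
    have : c • v ∈ W.toSubmodule := by rw [← hp]; exact Submodule.projection_apply_mem hc v
    exact (W.toSubmodule.smul_mem_iff h0).1 this

theorem IrrChar.charInner_self {H : Type*} [Group H] [Finite H] (ρ : IrrChar H) :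
    charInner ρ ρ = 1 := by
  obtain ⟨_, n, σ, hσ, rfl⟩ := ρ
  rw [charInner_self_eq_finrank, σ.isIrreducible_iff_finrank_intertwiningMap.1 hσ, Nat.cast_one]

theorem IrrChar.charInner_of_ne {H : Type*} [Group H] [Finite H] {ρ τ : IrrChar H} (h : ρ ≠ τ) :
    charInner ρ τ = 0 := by
  classical
  obtain ⟨_, n, σ, hσ, rfl⟩ := ρ
  obtain ⟨_, m, θ, hθ, rfl⟩ := τ
  have := Fintype.ofFinite H
  have : Invertible (Nat.card H : ℂ) := invertibleOfNonzero (Nat.cast_ne_zero.2 Nat.card_pos.ne')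
  have h1 := Representation.char_orthonormal σ θ
  rw [if_neg fun ⟨e⟩ => h (Subtype.ext (Representation.char_iso e).symm)] at h1
  simpa only [charInner, finsum_eq_sum_of_fintype, Representation.character_inv_eq_conj] using h1

theorem isIrrChar_character_iff {H : Type*} [Group H] [Finite H] {n : ℕ}
    (σ : Representation ℂ H (Fin n → ℂ)) :
    IsIrrChar σ.character ↔ charInner σ.character σ.character = 1 := by
  refine ⟨fun h => IrrChar.charInner_self ⟨_, h⟩, fun h => ⟨n, σ, ?_, rfl⟩⟩
  rw [charInner_self_eq_finrank] at h
  exact σ.isIrreducible_iff_finrank_intertwiningMap.2 (by exact_mod_cast h)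

/-! ### Characters of a finite abelian group -/

theorem sum_monoidHom_units_apply_eq_zero {A : Type*} [CommGroup A] [Finite A]
    [Fintype (A →* ℂˣ)] {a : A} (ha : a ≠ 1) : ∑ χ : A →* ℂˣ, ((χ a : ℂˣ) : ℂ) = 0 := by
  obtain ⟨φ, hφ⟩ := CommGroup.exists_apply_ne_one_of_hasEnoughRootsOfUnity A ℂ ha
  have h : ((φ a : ℂˣ) : ℂ) * ∑ χ : A →* ℂˣ, ((χ a : ℂˣ) : ℂ) =
      ∑ χ : A →* ℂˣ, ((χ a : ℂˣ) : ℂ) := by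
    rw [Finset.mul_sum]
    exact Fintype.sum_equiv (Equiv.mulLeft φ) _ _ fun χ => by simp
  by_contra hs
  exact hφ (Units.ext (mul_right_cancel₀ hs (h.trans (one_mul _).symm)))

/-! ### Conjugacy classes in a coset -/

theorem mk_mem_cosetClasses_iff {G : Type*} [Group G] (N : Subgroup G) [N.Normal]
    [IsMulCommutative (G ⧸ N)] {q h : G} :
    ConjClasses.mk h ∈ cosetClasses N q ↔ (h : G ⧸ N) = q := by
  have hmem : ∀ x : G, x ∈ q • (N : Set G) ↔ (x : G ⧸ N) = q := fun x => by
    rw [mem_leftCoset_iff, SetLike.mem_coe, eq_comm, QuotientGroup.eq]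
  refine ⟨fun hc => (hmem h).1 (hc ConjClasses.mem_carrier_mk), fun hh x hx => (hmem x).2 ?_⟩
  obtain ⟨c, rfl⟩ := isConj_iff.1 (ConjClasses.mk_eq_mk_iff_isConj.1
    (ConjClasses.mem_carrier_iff_mk_eq.1 hx).symm)
  rw [QuotientGroup.mk_mul, QuotientGroup.mk_mul, QuotientGroup.mk_inv, mul_comm' (c : G ⧸ N),
    mul_inv_cancel_right, hh]

/-- Burnside's lemma for the conjugation action of `G` on the coset `qN`, which is stable because
`G ⧸ N` is commutative: the orbits are the members of `cosetClasses N q`. -/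
theorem ncard_cosetClasses_mul_card {G : Type*} [Group G] [Finite G] (N : Subgroup G) [N.Normal]
    [IsMulCommutative (G ⧸ N)] (q : G) :
    (cosetClasses N q).ncard * Nat.card G =
      ∑ᶠ g : G, {h : G | (h : G ⧸ N) = q ∧ g * h = h * g}.ncard := by
  have := Fintype.ofFinite G
  let X : SubMulAction (ConjAct G) G :=
    { carrier := {h | (h : G ⧸ N) = q}
      smul_mem' := fun g h hh => by
        have hh' : (h : G ⧸ N) = q := hh
        simp only [ConjAct.smul_def, Set.mem_ofPred_eq, QuotientGroup.mk_mul,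
          QuotientGroup.mk_inv, hh']
        rw [mul_comm' _ (q : G ⧸ N), mul_inv_cancel_right] }
  have e1 := Nat.card_congr (MulAction.sigmaFixedByEquivOrbitsProdGroup (ConjAct G) X)
  rw [Nat.card_prod, Nat.card_sigma] at e1
  have hrel : ∀ x y : X, MulAction.orbitRel (ConjAct G) X x y ↔
      ConjClasses.mk (x : G) = ConjClasses.mk (y : G) := fun x y => by
    rw [MulAction.orbitRel_apply, SubMulAction.mem_orbit_subMul_iff, ConjAct.mem_orbit_conjAct,
      ConjClasses.mk_eq_mk_iff_isConj]
  have e2 : Nat.card (Quotient (MulAction.orbitRel (ConjAct G) X)) = (cosetClasses N q).ncard := by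
    rw [← Nat.card_coe_set_eq]
    refine Nat.card_congr (Equiv.ofBijective (Quotient.lift (fun x : X =>
      (⟨ConjClasses.mk (x : G), (mk_mem_cosetClasses_iff N).2 x.2⟩ : cosetClasses N q))
      fun x y h => Subtype.ext ((hrel x y).1 h)) ⟨?_, ?_⟩)
    · rintro ⟨x⟩ ⟨y⟩ h
      exact Quotient.sound ((hrel x y).2 (congrArg Subtype.val h))
    · rintro ⟨⟨h⟩, hc⟩
      exact ⟨Quotient.mk _ ⟨h, (mk_mem_cosetClasses_iff N).1 hc⟩, rfl⟩
  rw [finsum_eq_sum_of_fintype, ← e2]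
  refine e1.symm.trans (Fintype.sum_equiv ConjAct.ofConjAct.toEquiv _ _ fun g => ?_)
  rw [← Nat.card_coe_set_eq]
  refine Nat.card_congr
    { toFun := fun x => ⟨x.1.1, x.1.2, mul_inv_eq_iff_eq_mul.1 (congrArg Subtype.val x.2)⟩
      invFun := fun h => ⟨⟨h.1, h.2.1⟩, Subtype.ext (mul_inv_eq_iff_eq_mul.2 h.2.2)⟩
      left_inv := fun _ => rfl
      right_inv := fun _ => rfl }

/-- The centralizer of `g` meets `qN` in the empty set or in a coset of the centralizer of `g` in
`N`; in the second case it also meets `q ^ k N`, in a set of the same size. Burnside's lemma turns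
this comparison for each `g` into one of class numbers. -/
theorem ncard_cosetClasses_le_pow {G : Type*} [Group G] [Finite G] (N : Subgroup G) [N.Normal]
    [IsMulCommutative (G ⧸ N)] (q : G) (k : ℕ) :
    (cosetClasses N q).ncard ≤ (cosetClasses N (q ^ k)).ncard := by
  have := Fintype.ofFinite G
  refine le_of_mul_le_mul_right ?_ (Nat.card_pos (α := G))
  rw [ncard_cosetClasses_mul_card, ncard_cosetClasses_mul_card, finsum_eq_sum_of_fintype,
    finsum_eq_sum_of_fintype]
  refine Finset.sum_le_sum fun g _ => ?_
  rcases Set.eq_empty_or_nonempty {h : G | (h : G ⧸ N) = q ∧ g * h = h * g} with h | ⟨h₀, hq, hg⟩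
  · simp [h]
  -- translation by `h₀⁻¹ * h₀ ^ k`, which commutes with `g`, carries one coset to the other
  have hcomm : Commute g (h₀⁻¹ * h₀ ^ k) :=
    (Commute.inv_right hg).mul_right (Commute.pow_right hg k)
  refine Set.ncard_le_ncard_of_injOn (fun h => h * (h₀⁻¹ * h₀ ^ k)) ?_
    (fun _ _ _ _ h => mul_right_cancel h) (Set.toFinite _)
  rintro h ⟨h1, h2⟩
  refine ⟨?_, (Commute.mul_right (show Commute g h from h2) hcomm)⟩
  simp only [QuotientGroup.mk_mul, QuotientGroup.mk_inv, QuotientGroup.mk_pow, h1, hq,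
    mul_inv_cancel_left]

/-! ### Stabilizers under twisting -/

section Stabilizer

open scoped IsMulCommutative

variable {G : Type*} [Group G] [Finite G] (N : Subgroup G) [N.Normal] [IsMulCommutative (G ⧸ N)]

theorem finite_quotDual : Finite (QuotDual N) :=
  Nat.finite_of_card_ne_zero (by
    rw [CommGroup.card_monoidHom_of_hasEnoughRootsOfUnity (G ⧸ N) ℂ]
    exact Nat.card_pos.ne')

theorem sum_quotDual_apply [Fintype (QuotDual N)] [DecidableEq (G ⧸ N)] (a : G ⧸ N) :
    ∑ χ : QuotDual N, ((χ a : ℂˣ) : ℂ) = if a = 1 then (Nat.card (G ⧸ N) : ℂ) else 0 := by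
  split_ifs with h
  · subst h
    have := CommGroup.card_monoidHom_of_hasEnoughRootsOfUnity (G ⧸ N) ℂ
    rw [← this]
    simp
  · exact sum_monoidHom_units_apply_eq_zero h

/-- Averaging `χ(q)⁻¹ ⟨χ • ρ, ρ⟩` over all `χ` in two ways: orthogonality of the characters of
`G ⧸ N` leaves the terms in the coset `qN`, and orthogonality of irreducible characters of `G`
leaves the `χ` that fix `ρ`. -/
theorem sum_coset_mul_conj (ρ : IrrChar G) (q : G) :
    (Nat.card N : ℂ)⁻¹ * ∑ᶠ n : N, ρ (q * n) * starRingEnd ℂ (ρ (q * n)) =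
      ∑ᶠ χ : charStab N ρ, (((χ : QuotDual N) (q : G ⧸ N)⁻¹ : ℂˣ) : ℂ) := by
  classical
  have := Fintype.ofFinite G
  have := finite_quotDual N
  have := Fintype.ofFinite (QuotDual N)
  have hinner : ∀ χ : QuotDual N, charInner (χ • ρ : IrrChar G) ρ =
      if χ ∈ charStab N ρ then 1 else 0 := fun χ => by
    split_ifs with h
    · rw [MulAction.mem_stabilizer_iff.1 h]; exact ρ.charInner_self
    · exact IrrChar.charInner_of_ne h
  have hG : (Nat.card G : ℂ) = Nat.card (G ⧸ N) * Nat.card N := by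
    rw [← Nat.cast_mul, ← N.card_eq_card_quotient_mul_card_subgroup]
  have hQ0 : (Nat.card (G ⧸ N) : ℂ) ≠ 0 := Nat.cast_ne_zero.2 Nat.card_pos.ne'
  have hN0 : (Nat.card N : ℂ) ≠ 0 := Nat.cast_ne_zero.2 Nat.card_pos.ne'
  calc (Nat.card N : ℂ)⁻¹ * ∑ᶠ n : N, ρ (q * n) * starRingEnd ℂ (ρ (q * n))
      = (Nat.card G : ℂ)⁻¹ * ∑ g : G,
          (if (q : G ⧸ N)⁻¹ * g = 1 then (Nat.card (G ⧸ N) : ℂ) else 0) *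
            (ρ g * starRingEnd ℂ (ρ g)) := by
        rw [finsum_eq_sum_of_fintype]
        simp only [ite_mul, zero_mul]
        rw [← Finset.sum_filter, ← Finset.mul_sum, hG]
        have : ∑ n : N, ρ (q * n) * starRingEnd ℂ (ρ (q * n)) =
            ∑ g ∈ Finset.univ.filter (fun g : G => (q : G ⧸ N)⁻¹ * (g : G ⧸ N) = 1),
              ρ g * starRingEnd ℂ (ρ g) := by
          -- the coset `qN` is the set of `g` with `(q : G ⧸ N)⁻¹ * g = 1`
          refine Finset.sum_bij (fun n _ => q * n) (fun n _ => by simp) (fun a _ b _ h =>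
            Subtype.ext (mul_left_cancel h)) (fun g hg => ?_) (fun _ _ => rfl)
          have hg' : q⁻¹ * g ∈ N := by
            rw [← QuotientGroup.eq_one_iff]; simpa using hg
          exact ⟨⟨_, hg'⟩, Finset.mem_univ _, mul_inv_cancel_left q g⟩
        rw [this]
        field_simp
    _ = ∑ χ : QuotDual N, ((χ (q : G ⧸ N)⁻¹ : ℂˣ) : ℂ) * charInner (χ • ρ : IrrChar G) ρ := by
        simp only [← sum_quotDual_apply N, charInner, finsum_eq_sum_of_fintype, Finset.mul_sum,
          Finset.sum_mul, quotDual_smul_apply]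
        rw [Finset.sum_comm]
        refine Finset.sum_congr rfl fun χ _ => Finset.sum_congr rfl fun g _ => ?_
        rw [map_mul, Units.val_mul]
        ring
    _ = ∑ᶠ χ : charStab N ρ, (((χ : QuotDual N) (q : G ⧸ N)⁻¹ : ℂˣ) : ℂ) := by
        simp only [hinner, mul_ite, mul_one, mul_zero]
        rw [← Finset.sum_filter, finsum_eq_sum_of_fintype]
        exact Finset.sum_subtype _ (fun χ => by simp) _

theorem card_charStab_eq_charInner (ρ : IrrChar G) :
    (Nat.card (charStab N ρ) : ℂ) = charInner (resFun N ρ) (resFun N ρ) := by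
  have := finite_quotDual N
  have := Fintype.ofFinite (charStab N ρ)
  have h := sum_coset_mul_conj N ρ 1
  simp only [QuotientGroup.mk_one, inv_one, map_one, Units.val_one, one_mul] at h
  rw [charInner]
  refine Eq.trans ?_ h.symm
  rw [finsum_eq_sum_of_fintype, Finset.sum_const, nsmul_one, Finset.card_univ,
    Nat.card_eq_fintype_card]

theorem charOrbit_mem_cosetOrbits_iff_mem_ker (ρ : IrrChar G) (q : G) :
    charOrbit N ρ ∈ cosetOrbits N q ↔ ∀ χ ∈ charStab N ρ, χ (q : G ⧸ N) = 1 := by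
  have := finite_quotDual N
  have := Fintype.ofFinite (charStab N ρ)
  rw [charOrbit_mem_cosetOrbits_iff]
  constructor
  · rintro ⟨_, ⟨n, hn, rfl⟩, h0⟩ χ hχ
    have h1 : ((χ ((q * n : G) : G ⧸ N) : ℂˣ) : ℂ) * ρ (q * n) = ρ (q * n) :=
      congrArg (fun τ : IrrChar G => τ (q * n)) (MulAction.mem_stabilizer_iff.1 hχ)
    rw [QuotientGroup.mk_mul_of_mem q hn] at h1
    exact Units.ext (mul_right_cancel₀ h0 (h1.trans (one_mul _).symm))
  · intro h
    by_contra! h0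
    have h1 := sum_coset_mul_conj N ρ q
    rw [finsum_congr fun n : N => by rw [h0 (q * n) ⟨n, n.2, rfl⟩, zero_mul], finsum_zero, mul_zero,
      finsum_eq_sum_of_fintype, Finset.sum_congr rfl fun χ _ => by
        rw [map_inv, h χ χ.2, inv_one, Units.val_one],
      Finset.sum_const, nsmul_one, Finset.card_univ] at h1
    exact Nat.cast_ne_zero.2 Fintype.card_ne_zero h1.symm

theorem charOrbit_mem_cosetOrbits_iff_charStab_eq_bot {q : G}
    (hq : Subgroup.zpowers (q : G ⧸ N) = ⊤) (ρ : IrrChar G) :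
    charOrbit N ρ ∈ cosetOrbits N q ↔ charStab N ρ = ⊥ := by
  rw [charOrbit_mem_cosetOrbits_iff_mem_ker, Subgroup.eq_bot_iff_forall]
  refine forall₂_congr fun χ _ => ⟨fun h => MonoidHom.ext fun x => ?_, fun h => by simp [h]⟩
  obtain ⟨m, rfl⟩ := Subgroup.mem_zpowers_iff.1 (hq ▸ Subgroup.mem_top x)
  simp [h]

theorem charStab_eq_bot_iff_isIrrChar_resFun (ρ : IrrChar G) :
    charStab N ρ = ⊥ ↔ IsIrrChar (resFun N ρ) := by
  have h1 := card_charStab_eq_charInner N ρ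
  obtain ⟨n, σ, -, hσ⟩ := ρ.2
  let σN : Representation ℂ N (Fin n → ℂ) := σ.comp N.subtype
  have hres : resFun N ρ = σN.character := by
    funext x
    rw [resFun, ← hσ]
    rfl
  rw [← Subgroup.card_eq_one, hres, isIrrChar_character_iff, ← hres, ← h1, Nat.cast_eq_one]

end Stabilizer

theorem lemma2 {G : Type*} [Group G] [Finite G] (N : Subgroup G) [N.Normal]
    [IsMulCommutative (G ⧸ N)] :
    -- (1)
    (∀ ρ : IrrChar G,
      (Nat.card (charStab N ρ) : ℂ) = charInner (resFun N ρ) (resFun N ρ)) ∧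
    -- (2)
    (∀ (ρ : IrrChar G) (q : G),
      charOrbit N ρ ∈ cosetOrbits N q ↔ (q : G ⧸ N) ∈ ⨅ χ ∈ charStab N ρ, MonoidHom.ker χ) ∧
    -- (3)
    (∀ (q : G) (k : ℕ), 1 ≤ k →
      cosetOrbits N q ⊆ cosetOrbits N (q ^ k) ∧
        (cosetClasses N q).ncard ≤ (cosetClasses N (q ^ k)).ncard) ∧
    -- (4)
    (∀ q : G, Subgroup.zpowers (q : G ⧸ N) = ⊤ → ∀ ρ : IrrChar G,
      (charOrbit N ρ ∈ cosetOrbits N q ↔ charStab N ρ = ⊥) ∧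
        (charStab N ρ = ⊥ ↔ IsIrrChar (resFun N ρ))) := by
  refine ⟨card_charStab_eq_charInner N, fun ρ q => ?_, fun q k _ => ⟨?_, ?_⟩, fun q hq ρ =>
    ⟨charOrbit_mem_cosetOrbits_iff_charStab_eq_bot N hq ρ,
      charStab_eq_bot_iff_isIrrChar_resFun N ρ⟩⟩
  · simp only [charOrbit_mem_cosetOrbits_iff_mem_ker, Subgroup.mem_iInf, MonoidHom.mem_ker]
  · rintro ⟨ρ⟩ hρ
    refine (charOrbit_mem_cosetOrbits_iff_mem_ker N ρ _).2 fun χ hχ => ?_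
    rw [QuotientGroup.mk_pow, map_pow,
      (charOrbit_mem_cosetOrbits_iff_mem_ker N ρ q).1 hρ χ hχ, one_pow]
  · exact ncard_cosetClasses_le_pow N q k
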